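/- For $a,b\ge 0$, coefficients $\alpha,\beta\ge 0$ and $r\in[-\infty,\infty]$ let $M_r^{(\alpha,\beta)}(a,b)=0$ if $ab=0$, and, if $ab>0$, let $M_r^{(\alpha,\beta)}(a,b)$ be $(\alpha a^r+\beta b^r)^{1/r}$ if $r\ne 0,\pm\infty$, $a^\alpha b^\beta$ if $r=0$, $\max\{a,b\}$ if $r=+\infty$, and $\min\{a,b\}$ if $r=-\infty$. For $p\ge 1$, $1/p+1/q=1$ and $\lambda,t\in[0,1]$ put $$C_{p,\lambda,t}=(1-t)^{1/p}(1-\lambda)^{1/q},\qquad D_{p,\lambda,t}=t^{1/p}\lambda^{1/q}$$ (for $p=1$ we have $1/q=0$, and the factors $(1-\lambda)^{1/q}$ and $\lambda^{1/q}$ are $1$). Theorem ($L_p$-Borell–Brascamp–Lieb inequality for all $s\in(-\infty,\infty)$). Let $n\ge 1$, $p\ge 1$, $-\infty<s<\infty$ and $t\in(0,1)$, and let $f,g,h:\mathbb{R}^n\to[0,\infty)$ be bounded integrable functions such that $$h\left(C_{p,\lambda,t}x+D_{p,\lambda,t}y\right)\ \ge\ M_s^{(C_{p,\lambda,t},D_{p,\lambda,t})}(f(x),g(y))$$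 for all $x$ with $f(x)>0$, all $y$ with $g(y)>0$ and all $\lambda\in[0,1]$. Let $\gamma=\frac{s}{1+ns}$, with $\gamma=-\infty$ (and $p\gamma=-\infty$) if $s=-1/n$. Then: (i) if $s\ge-\frac1n$, then $$\int_{\mathbb{R}^n}h\ \ge\ M_{p\gamma}^{(1-t,t)}\left(\int_{\mathbb{R}^n}f,\int_{\mathbb{R}^n}g\right);$$ (ii) if $s<-\frac1n$, then for every $\lambda\in[0,1]$ $$\int_{\mathbb{R}^n}h\ \ge\ \min\left\{C_{p,\lambda,t}^{1/\gamma}\int_{\mathbb{R}^n}f,\ D_{p,\lambda,t}^{1/\gamma}\int_{\mathbb{R}^n}g\right\}.$$ -/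

import Mathlib

open MeasureTheory

noncomputable section

/-- The `L_p` coefficient `C_{p,λ,t} = (1 - t)^(1/p) (1 - λ)^(1/q)`, where `1/q = 1 - 1/p`
(for `p = 1` the second factor is `1`, since `0 ^ 0 = 1`). -/
def lpCoeffC (p lam t : ℝ) : ℝ := (1 - t) ^ (1 / p) * (1 - lam) ^ (1 - 1 / p)

/-- The `L_p` coefficient `D_{p,λ,t} = t^(1/p) λ^(1/q)`, where `1/q = 1 - 1/p`. -/
def lpCoeffD (p lam t : ℝ) : ℝ := t ^ (1 / p) * lam ^ (1 - 1 / p)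

open Classical in
/-- The `s`-mean `M_s^{(α,β)}(a,b)` of `a, b ≥ 0` with coefficients `α, β ≥ 0` (not necessarily
of sum `1`), for `s ∈ [-∞,∞]`; it is `0` unless `ab > 0`. -/
def sMean (s : EReal) (α β a b : ℝ) : ℝ :=
  if 0 < a * b then
    if s = ⊥ then min a b
    else if s = ⊤ then max a b
    else if s = 0 then a ^ α * b ^ β
    else (α * a ^ s.toReal + β * b ^ s.toReal) ^ (1 / s.toReal)
  else 0

open Classical in
/-- The exponent `γ = s / (1 + n s)` for `s ≥ -1/n`, read as `-∞` at `s = -1/n`. -/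
def bblExponent (n : ℕ) (s : ℝ) : EReal :=
  if 1 + (n : ℝ) * s = 0 then ⊥ else ((s / (1 + (n : ℝ) * s) : ℝ) : EReal)

end

/-! Everything reduces to the exponent `-1/n` with unit coefficients: if `(f(x)^(-1/n) +
g(y)^(-1/n))^(-n) ≤ h(x+y)`, then `min (∫f) (∫g) ≤ ∫h`. This is the case `k = 0` of a family,
exponent `-1/(n+k)` pointwise and `-1/k` for the integrals, which Fubini makes accessible to
induction on dimension (`negPowerSum_lintegral_le_pi`). On the line, dividing by the suprema makes
Brunn–Minkowski applicable to superlevel sets; it bounds a sum of normalised integrals, which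
Radon's inequality compares with the power sum.

Dilations and scalar factors then introduce four free constants (`min_mul_integral_le`). For `s >
-1/n` they are chosen so that both entries of the minimum equal the desired bound, and the pointwise
hypothesis becomes monotonicity of power means from `-1/n` to `s`. For `s ≤ -1/n` subadditivity of a
power in `(0,1]` suffices.

These inequalities hold for each fixed `λ`. For `s > -1/n`, `s ≠ 0`, the `λ` giving equality in
Hölder turns `C F^γ + D G^γ` into `((1-t) F^(pγ) + t G^(pγ))^(1/p)`; for `s = 0` and `s = -1/n`, `λ
= t` is enough. -/

open Set Filter Topology
open scoped ENNReal NNReal Pointwise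

/-! ### Brunn–Minkowski on the line -/

/-- The one-dimensional Brunn–Minkowski inequality for compact sets. -/
theorem volume_add_volume_le_of_isCompact {K L : Set ℝ} (hK : IsCompact K) (hL : IsCompact L)
    (hK0 : K.Nonempty) (hL0 : L.Nonempty) : volume K + volume L ≤ volume (K + L) := by
  obtain ⟨a, haK, ha⟩ := hK.exists_isGreatest hK0
  obtain ⟨b, hbL, hb⟩ := hL.exists_isLeast hL0
  -- As `a = max K` and `b = min L`, the translate `K + b` lies to the left of `a + b` and `a + L`
  -- to its right.
  have h1 : (fun x => x + b) '' K ∪ (fun y => a + y) '' L ⊆ K + L := by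
    rintro z (⟨x, hx, rfl⟩ | ⟨y, hy, rfl⟩)
    · exact add_mem_add hx hbL
    · exact add_mem_add haK hy
  have h2 : AEDisjoint volume ((fun x => x + b) '' K) ((fun y => a + y) '' L) := by
    refine measure_mono_null (t := {a + b}) ?_ (by simp)
    rintro z ⟨⟨x, hx, rfl⟩, ⟨y, hy, hxy⟩⟩
    have := ha hx
    have := hb hy
    simp only [mem_singleton_iff] at *
    linarith
  have h3 : MeasurableSet ((fun y => a + y) '' L) :=
    (hL.image (continuous_const.add continuous_id)).measurableSet
  calc volume K + volume L
      = volume ((fun x => x + b) '' K) + volume ((fun y => a + y) '' L) := by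
        simp [image_add_right, image_add_left, measure_preimage_add_right, measure_preimage_add]
    _ = volume ((fun x => x + b) '' K ∪ (fun y => a + y) '' L) :=
        (measure_union₀ h3.nullMeasurableSet h2).symm
    _ ≤ volume (K + L) := measure_mono h1

/-- The one-dimensional Brunn–Minkowski inequality. -/
theorem volume_add_volume_le {X Y : Set ℝ} (hX : MeasurableSet X) (hY : MeasurableSet Y)
    (hX0 : X.Nonempty) (hY0 : Y.Nonempty) : volume X + volume Y ≤ volume (X + Y) := by
  have key : ∀ r < volume X + volume Y, r ≤ volume (X + Y) := by
    intro r hr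
    -- Splitting `r` below the sum needs both measures nonzero; if one vanishes, a translate of the
    -- other set inside `X + Y` suffices.
    rcases eq_or_ne (volume X) 0 with h0 | h0
    · obtain ⟨x, hx⟩ := hX0
      rw [h0, zero_add] at hr
      refine hr.le.trans ?_
      calc volume Y = volume ((fun y => x + y) '' Y) := by
            simp [image_add_left, measure_preimage_add]
        _ ≤ _ := measure_mono (by rintro _ ⟨y, hy, rfl⟩; exact add_mem_add hx hy)
    rcases eq_or_ne (volume Y) 0 with h1 | h1
    · obtain ⟨y, hy⟩ := hY0
      rw [h1, add_zero] at hr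
      refine hr.le.trans ?_
      calc volume X = volume ((fun x => x + y) '' X) := by
            simp [image_add_right, measure_preimage_add_right]
        _ ≤ _ := measure_mono (by rintro _ ⟨x, hx, rfl⟩; exact add_mem_add hx hy)
    obtain ⟨u, hu, v, hv, huv⟩ := ENNReal.exists_lt_add_of_lt_add hr h0 h1
    obtain ⟨K, hKX, hK, huK⟩ := hX.exists_lt_isCompact hu
    obtain ⟨L, hLY, hL, hvL⟩ := hY.exists_lt_isCompact hv
    have hK0 : K.Nonempty := nonempty_of_measure_ne_zero (pos_of_gt huK).ne'
    have hL0 : L.Nonempty := nonempty_of_measure_ne_zero (pos_of_gt hvL).ne'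
    calc r ≤ u + v := huv.le
      _ ≤ volume K + volume L := add_le_add huK.le hvL.le
      _ ≤ volume (K + L) := volume_add_volume_le_of_isCompact hK hL hK0 hL0
      _ ≤ volume (X + Y) := measure_mono (add_subset_add hKX hLY)
  exact le_of_forall_lt_imp_le_of_dense key

/-! ### Layer-cake argument for functions of supremum one -/

theorem setLIntegral_Ioo_measure_lt {α : Type*} [MeasurableSpace α] (μ : Measure α)
    {u : α → ℝ≥0∞} (hu : Measurable u) :
    ∫⁻ t in Ioo (0 : ℝ) 1, μ {x | ENNReal.ofReal t < u x} = ∫⁻ x, min (u x) 1 ∂μ := by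
  have hfin : ∀ x, min (u x) 1 ≠ ∞ := fun x => ne_top_of_le_ne_top ENNReal.one_ne_top (min_le_right _ _)
  have h1 : ∫⁻ x, min (u x) 1 ∂μ = ∫⁻ x, ENNReal.ofReal (min (u x) 1).toReal ∂μ := by
    simp_rw [ENNReal.ofReal_toReal (hfin _)]
  rw [h1, lintegral_eq_lintegral_meas_lt μ (Eventually.of_forall fun _ => ENNReal.toReal_nonneg)
    (hu.min measurable_const).ennreal_toReal.aemeasurable]
  have hset : ∀ t ∈ Ioi (0 : ℝ), μ {a | t < (min (u a) 1).toReal} =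
      (Ioo (0 : ℝ) 1).indicator (fun t => μ {x | ENNReal.ofReal t < u x}) t := by
    intro t ht
    have ht0 : (0 : ℝ) ≤ t := le_of_lt ht
    have e : ∀ a, t < (min (u a) 1).toReal ↔ ENNReal.ofReal t < min (u a) 1 := fun a =>
      (ENNReal.ofReal_lt_iff_lt_toReal ht0 (hfin a)).symm
    simp_rw [e]
    by_cases h : t < 1
    · rw [indicator_of_mem (show t ∈ Ioo (0 : ℝ) 1 from ⟨ht, h⟩)]
      have : ENNReal.ofReal t < 1 := by rwa [ENNReal.ofReal_lt_one]
      simp [this]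
    · rw [indicator_of_notMem (fun h' : t ∈ Ioo (0 : ℝ) 1 => h h'.2)]
      have : ¬ ENNReal.ofReal t < 1 := by rwa [ENNReal.ofReal_lt_one]
      simp [this]
  rw [setLIntegral_congr_fun measurableSet_Ioi hset, setLIntegral_indicator measurableSet_Ioo,
    inter_eq_left.2 Ioo_subset_Ioi_self]

/-- Since both suprema are 1, the superlevel sets of `f` and `g` are nonempty at every level below
1, as Brunn–Minkowski requires, and their sum lies in that of `h`. Integrating over the levels gives
the claim. -/
theorem lintegral_add_lintegral_le_of_iSup_eq_one {f g h : ℝ → ℝ≥0∞} (hf : Measurable f)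
    (hg : Measurable g) (hh : Measurable h) (hf1 : ⨆ x, f x = 1) (hg1 : ⨆ x, g x = 1)
    (hfgh : ∀ x y, min (f x) (g y) ≤ h (x + y)) :
    (∫⁻ x, f x) + (∫⁻ x, g x) ≤ ∫⁻ x, h x := by
  have ef : ∫⁻ x, f x = ∫⁻ x, min (f x) 1 := by
    congr 1 with x
    exact (min_eq_left (hf1 ▸ le_iSup f x)).symm
  have eg : ∫⁻ x, g x = ∫⁻ x, min (g x) 1 := by
    congr 1 with x
    exact (min_eq_left (hg1 ▸ le_iSup g x)).symm
  have hm : Measurable fun t : ℝ => volume {x | ENNReal.ofReal t < f x} :=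
    Antitone.measurable fun s t hst => measure_mono fun x hx =>
      (ENNReal.ofReal_le_ofReal hst).trans_lt hx
  rw [ef, eg]
  refine le_trans ?_ (lintegral_mono fun x => min_le_left (h x) 1)
  rw [← setLIntegral_Ioo_measure_lt _ hf, ← setLIntegral_Ioo_measure_lt _ hg,
    ← setLIntegral_Ioo_measure_lt _ hh, ← lintegral_add_left hm]
  refine setLIntegral_mono' measurableSet_Ioo fun t ht => ?_
  have ht1 : ENNReal.ofReal t < 1 := by rw [ENNReal.ofReal_lt_one]; exact ht.2
  refine (volume_add_volume_le (measurableSet_lt measurable_const hf)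
    (measurableSet_lt measurable_const hg) ?_ ?_).trans (measure_mono ?_)
  · exact lt_iSup_iff.1 (hf1 ▸ ht1)
  · exact lt_iSup_iff.1 (hg1 ▸ ht1)
  · rintro _ ⟨x, hx, y, hy, rfl⟩
    exact (lt_min hx hy).trans_le (hfgh x y)

/-! ### Algebra of negative power sums -/

/-- The unnormalised power sum `(a ^ (-1/k) + b ^ (-1/k)) ^ (-k)`, read as `min a b` for `k = 0`. -/
noncomputable def negPowerSum (k : ℕ) (a b : ℝ≥0∞) : ℝ≥0∞ :=
  if k = 0 then min a b else (((a ^ (1 / (k : ℝ)))⁻¹ + (b ^ (1 / (k : ℝ)))⁻¹)⁻¹) ^ k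

theorem negPowerSum_zero (a b : ℝ≥0∞) : negPowerSum 0 a b = min a b := if_pos rfl

theorem negPowerSum_of_ne_zero {k : ℕ} (hk : k ≠ 0) (a b : ℝ≥0∞) :
    negPowerSum k a b = (((a ^ (1 / (k : ℝ)))⁻¹ + (b ^ (1 / (k : ℝ)))⁻¹)⁻¹) ^ k := if_neg hk

theorem negPowerSum_mono (k : ℕ) {a a' b b' : ℝ≥0∞} (ha : a ≤ a') (hb : b ≤ b') :
    negPowerSum k a b ≤ negPowerSum k a' b' := by
  unfold negPowerSum
  split_ifs
  · exact min_le_min ha hb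
  · gcongr

theorem negPowerSum_zero_left (k : ℕ) (b : ℝ≥0∞) : negPowerSum k 0 b = 0 := by
  rcases eq_or_ne k 0 with rfl | hk
  · simp [negPowerSum_zero]
  · have : (0 : ℝ) < 1 / k := by positivity
    rw [negPowerSum_of_ne_zero hk, ENNReal.zero_rpow_of_pos this]
    simp [hk]

theorem negPowerSum_zero_right (k : ℕ) (a : ℝ≥0∞) : negPowerSum k a 0 = 0 := by
  rcases eq_or_ne k 0 with rfl | hk
  · simp [negPowerSum_zero]
  · have : (0 : ℝ) < 1 / k := by positivity
    rw [negPowerSum_of_ne_zero hk, ENNReal.zero_rpow_of_pos this]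
    simp [hk]

theorem tendsto_negPowerSum (k : ℕ) {ι : Type*} {l : Filter ι} {u v : ι → ℝ≥0∞} {a b : ℝ≥0∞}
    (hu : Tendsto u l (𝓝 a)) (hv : Tendsto v l (𝓝 b)) :
    Tendsto (fun i => negPowerSum k (u i) (v i)) l (𝓝 (negPowerSum k a b)) := by
  rcases eq_or_ne k 0 with rfl | hk
  · simpa only [negPowerSum_zero] using Tendsto.min hu hv
  · simp only [negPowerSum_of_ne_zero hk]
    have hr : ∀ {w : ι → ℝ≥0∞} {c : ℝ≥0∞}, Tendsto w l (𝓝 c) →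
        Tendsto (fun i => (w i ^ (1 / (k : ℝ)))⁻¹) l (𝓝 (c ^ (1 / (k : ℝ)))⁻¹) := fun hw =>
      tendsto_inv_iff.2 (hw.ennrpow_const _)
    exact ENNReal.Tendsto.pow (tendsto_inv_iff.2 ((hr hu).add (hr hv)))

theorem negPowerSum_mul_right {k : ℕ} (hk : k ≠ 0) (a b : ℝ≥0∞) {c : ℝ≥0∞} (hc0 : c ≠ 0)
    (hc : c ≠ ∞) : negPowerSum k (a * c) (b * c) = negPowerSum k a b * c := by
  have h0 : (0 : ℝ) ≤ 1 / k := by positivity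
  have hr0 : c ^ (1 / (k : ℝ)) ≠ 0 := by simp [ENNReal.rpow_eq_zero_iff, hc0, hc]
  have hr : c ^ (1 / (k : ℝ)) ≠ ∞ := ENNReal.rpow_ne_top_of_nonneg h0 hc
  simp only [negPowerSum_of_ne_zero hk, ENNReal.mul_rpow_of_nonneg _ _ h0]
  rw [ENNReal.mul_inv (.inr hr) (.inr hr0), ENNReal.mul_inv (.inr hr) (.inr hr0), ← add_mul,
    ENNReal.mul_inv (.inr (by simpa using hr0)) (.inr (by simpa using hr)), inv_inv, mul_pow]
  congr 1
  rw [← ENNReal.rpow_natCast, ← ENNReal.rpow_mul, one_div_mul_cancel (by positivity),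
    ENNReal.rpow_one]

theorem negPowerSum_mul_min_le {k : ℕ} (hk : k ≠ 0) (a b : ℝ≥0∞) {u v : ℝ≥0∞} (hu : u ≤ 1) :
    negPowerSum k a b * min u v ≤ negPowerSum k (a * u) (b * v) := by
  rcases eq_or_ne (min u v) 0 with h0 | h0
  · simp [h0]
  · have h1 : min u v ≠ ∞ := ne_top_of_le_ne_top ENNReal.one_ne_top ((min_le_left _ _).trans hu)
    rw [← negPowerSum_mul_right hk _ _ h0 h1]
    exact negPowerSum_mono k (by gcongr; exact min_le_left _ _) (by gcongr; exact min_le_right _ _)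

/-- Radon's inequality for two terms. -/
theorem radon_inequality (k : ℕ) {x y u v : ℝ} (hx : 0 < x) (hy : 0 < y) (hu : 0 < u)
    (hv : 0 < v) : (x + y) ^ (k + 1) / (u + v) ^ k ≤ x ^ (k + 1) / u ^ k + y ^ (k + 1) / v ^ k := by
  have h := (convexOn_pow (k + 1)).2 (show x / u ∈ Ici (0 : ℝ) from (by positivity : 0 ≤ x / u))
    (show y / v ∈ Ici (0 : ℝ) from (by positivity : 0 ≤ y / v))
    (by positivity : 0 ≤ u / (u + v)) (by positivity : 0 ≤ v / (u + v)) (by field_simp)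
  simp only [smul_eq_mul] at h
  have e : u / (u + v) * (x / u) + v / (u + v) * (y / v) = (x + y) / (u + v) := by field_simp
  rw [e] at h
  calc (x + y) ^ (k + 1) / (u + v) ^ k = (u + v) * ((x + y) / (u + v)) ^ (k + 1) := by
        rw [div_pow, pow_succ (u + v)]; field_simp
    _ ≤ (u + v) * (u / (u + v) * (x / u) ^ (k + 1) + v / (u + v) * (y / v) ^ (k + 1)) := by gcongr
    _ = _ := by rw [div_pow, div_pow, pow_succ u, pow_succ v]; field_simp

theorem negPowerSum_pow {k : ℕ} (hk : k ≠ 0) {a b : ℝ≥0} (ha : a ≠ 0) (hb : b ≠ 0) :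
    negPowerSum k ((a ^ k : ℝ≥0) : ℝ≥0∞) ((b ^ k : ℝ≥0) : ℝ≥0∞) =
      (((a⁻¹ + b⁻¹)⁻¹ ^ k : ℝ≥0) : ℝ≥0∞) := by
  have h0 : (0 : ℝ) ≤ 1 / k := by positivity
  have e : ∀ c : ℝ≥0, ((c ^ k : ℝ≥0) : ℝ≥0∞) ^ (1 / (k : ℝ)) = c := by
    intro c
    rw [← ENNReal.coe_rpow_of_nonneg _ h0, ← NNReal.rpow_natCast, ← NNReal.rpow_mul,
      mul_one_div_cancel (by positivity), NNReal.rpow_one]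
  have hne : a⁻¹ + b⁻¹ ≠ 0 := by positivity
  rw [negPowerSum_of_ne_zero hk, e, e]
  push_cast [ENNReal.coe_inv ha, ENNReal.coe_inv hb, ENNReal.coe_inv hne]
  rfl

/-- Writing `A = a^(k+1)`, `B = b^(k+1)`, `F = f^k`, `G = g^k`, this is Radon's inequality for the
reciprocals of `a, b, f, g`. For `k = 0` the right side is a weighted average of `F` and `G`. The
gain from `-1/(k+1)` to `-1/k` in each dimension comes from here. -/
theorem negPowerSum_le_negPowerSum_succ_mul (k : ℕ) {A B : ℝ≥0∞} (hA0 : A ≠ 0) (hA : A ≠ ∞)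
    (hB0 : B ≠ 0) (hB : B ≠ ∞) (F G : ℝ≥0∞) :
    negPowerSum k F G ≤ negPowerSum (k + 1) A B * (F / A + G / B) := by
  have root : ∀ m : ℕ, m ≠ 0 → ∀ c : ℝ≥0, c ≠ 0 → ∃ d : ℝ≥0, d ≠ 0 ∧ d ^ m = c := fun m hm c hc =>
    ⟨c ^ (1 / (m : ℝ)), by simp [NNReal.rpow_eq_zero_iff, hc], by
      rw [← NNReal.rpow_natCast, ← NNReal.rpow_mul, one_div_mul_cancel (by positivity),
        NNReal.rpow_one]⟩
  lift A to ℝ≥0 using hA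
  lift B to ℝ≥0 using hB
  obtain ⟨a, ha, rfl⟩ := root (k + 1) k.succ_ne_zero A (by simpa using hA0)
  obtain ⟨b, hb, rfl⟩ := root (k + 1) k.succ_ne_zero B (by simpa using hB0)
  rw [negPowerSum_pow k.succ_ne_zero ha hb]
  have hc0 : (((a⁻¹ + b⁻¹)⁻¹ ^ (k + 1) : ℝ≥0) : ℝ≥0∞) ≠ 0 := by
    rw [ENNReal.coe_ne_zero]; positivity
  rcases eq_or_ne F 0 with rfl | hF0
  · simp [negPowerSum_zero_left]
  rcases eq_or_ne G 0 with rfl | hG0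
  · simp [negPowerSum_zero_right]
  rcases eq_or_ne F ∞ with rfl | hF
  · rw [ENNReal.top_div_coe, top_add, ENNReal.mul_top hc0]; exact le_top
  rcases eq_or_ne G ∞ with rfl | hG
  · rw [ENNReal.top_div_coe, add_top, ENNReal.mul_top hc0]; exact le_top
  lift F to ℝ≥0 using hF
  lift G to ℝ≥0 using hG
  have hF0' : F ≠ 0 := by simpa using hF0
  have hG0' : G ≠ 0 := by simpa using hG0
  rw [← ENNReal.coe_div (by positivity), ← ENNReal.coe_div (by positivity), ← ENNReal.coe_add,
    ← ENNReal.coe_mul]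
  have ha' : 0 < (a : ℝ) := by positivity
  have hb' : 0 < (b : ℝ) := by positivity
  rcases eq_or_ne k 0 with rfl | hk
  · rw [negPowerSum_zero, ← ENNReal.coe_min, ENNReal.coe_le_coe, ← NNReal.coe_le_coe]
    push_cast
    simp only [pow_one]
    have e : ((a : ℝ)⁻¹ + (b : ℝ)⁻¹)⁻¹ * (F / a + G / b) = (F * b + G * a) / (a + b) := by
      field_simp; ring
    rw [e, le_div_iff₀ (by positivity)]
    nlinarith [min_le_left (F : ℝ) G, min_le_right (F : ℝ) G]
  · obtain ⟨f, hf, rfl⟩ := root k hk F hF0'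
    obtain ⟨g, hg, rfl⟩ := root k hk G hG0'
    rw [negPowerSum_pow hk hf hg, ENNReal.coe_le_coe, ← NNReal.coe_le_coe]
    push_cast
    have hf' : 0 < (f : ℝ) := by positivity
    have hg' : 0 < (g : ℝ) := by positivity
    have h := radon_inequality k (inv_pos.2 ha') (inv_pos.2 hb') (inv_pos.2 hf') (inv_pos.2 hg')
    have e : ∀ c d : ℝ, c⁻¹ ^ (k + 1) / d⁻¹ ^ k = d ^ k / c ^ (k + 1) := by
      intro c d
      rw [inv_pow, inv_pow, div_inv_eq_mul, mul_comm, div_eq_mul_inv]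
    rw [e, e] at h
    rw [inv_pow, inv_pow, ← div_eq_inv_mul, le_div_iff₀ (by positivity), ← div_eq_inv_mul]
    exact h

/-! ### The inequality on the line and induction on dimension -/

theorem tendsto_lintegral_min_natCast {α : Type*} [MeasurableSpace α] (μ : Measure α)
    {u : α → ℝ≥0∞} (hu : Measurable u) :
    Tendsto (fun N : ℕ => ∫⁻ x, min (u x) N ∂μ) atTop (𝓝 (∫⁻ x, u x ∂μ)) := by
  refine lintegral_tendsto_of_tendsto_of_monotone
    (fun N => (hu.min measurable_const).aemeasurable) (Eventually.of_forall fun x => ?_)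
    (Eventually.of_forall fun x => ?_)
  · intro M N hMN
    exact min_le_min le_rfl (by exact_mod_cast hMN)
  · have h : Tendsto (fun N : ℕ => min (u x) N) atTop (𝓝 (min (u x) ∞)) :=
      Tendsto.min tendsto_const_nhds ENNReal.tendsto_nat_nhds_top
    rwa [min_eq_left le_top] at h

/-- One-dimensional Borell–Brascamp–Lieb inequality with negative exponent `-1/(k+1)`. -/
theorem negPowerSum_lintegral_le_real (k : ℕ) {f g h : ℝ → ℝ≥0∞} (hf : Measurable f)
    (hg : Measurable g) (hh : Measurable h)
    (hfgh : ∀ x y, negPowerSum (k + 1) (f x) (g y) ≤ h (x + y)) :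
    negPowerSum k (∫⁻ x, f x) (∫⁻ x, g x) ≤ ∫⁻ x, h x := by
  -- Truncation preserves the hypothesis by monotonicity; continuity of `negPowerSum` recovers the
  -- general case.
  wlog hbdd : (⨆ x, f x) ≠ ∞ ∧ (⨆ x, g x) ≠ ∞ generalizing f g
  · have hN : ∀ (u : ℝ → ℝ≥0∞) (N : ℕ), (⨆ x, min (u x) N) ≠ ∞ := fun u N =>
      ((iSup_le fun x => min_le_right (u x) (N : ℝ≥0∞)).trans_lt (ENNReal.natCast_lt_top N)).ne
    have hlim : Tendsto (fun N : ℕ => negPowerSum k (∫⁻ x, min (f x) N) (∫⁻ x, min (g x) N)) atTop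
        (𝓝 (negPowerSum k (∫⁻ x, f x) (∫⁻ x, g x))) :=
      tendsto_negPowerSum k (tendsto_lintegral_min_natCast volume hf)
        (tendsto_lintegral_min_natCast volume hg)
    refine le_of_tendsto hlim (Eventually.of_forall fun N => ?_)
    exact this (hf.min measurable_const) (hg.min measurable_const)
      (fun x y => (negPowerSum_mono _ (min_le_left _ _) (min_le_left _ _)).trans (hfgh x y))
      ⟨hN f N, hN g N⟩
  obtain ⟨hA, hB⟩ := hbdd
  set A := ⨆ x, f x with hAdef
  set B := ⨆ x, g x with hBdef
  rcases eq_or_ne A 0 with hA0 | hA0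
  · have : ∀ x, f x = 0 := by simpa [hAdef] using hA0
    simp [this, negPowerSum_zero_left]
  rcases eq_or_ne B 0 with hB0 | hB0
  · have : ∀ x, g x = 0 := by simpa [hBdef] using hB0
    simp [this, negPowerSum_zero_right]
  set c := negPowerSum (k + 1) A B with hc
  have hcpos : c ≠ 0 ∧ c ≠ ∞ := by
    have hr : (0 : ℝ) ≤ 1 / ((k + 1 : ℕ) : ℝ) := by positivity
    rw [hc, negPowerSum_of_ne_zero k.succ_ne_zero]
    refine ⟨pow_ne_zero _ ?_, ENNReal.pow_ne_top ?_⟩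
    · simp [ENNReal.rpow_eq_zero_iff, hA0, hB0, hA, hB]
    · rw [ENNReal.inv_ne_top]
      refine fun h0 => ENNReal.rpow_ne_top_of_nonneg hr hA ?_
      rw [← ENNReal.inv_eq_zero]
      exact (add_eq_zero.1 h0).1
  have hone : (∫⁻ x, f x / A) + (∫⁻ x, g x / B) ≤ ∫⁻ x, h x / c := by
    refine lintegral_add_lintegral_le_of_iSup_eq_one (hf.div_const _) (hg.div_const _)
      (hh.div_const _) ?_ ?_ fun x y => ?_
    · simp_rw [div_eq_mul_inv]
      rw [← ENNReal.iSup_mul, ← hAdef, ENNReal.mul_inv_cancel hA0 hA]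
    · simp_rw [div_eq_mul_inv]
      rw [← ENNReal.iSup_mul, ← hBdef, ENNReal.mul_inv_cancel hB0 hB]
    · rw [ENNReal.le_div_iff_mul_le (.inl hcpos.1) (.inl hcpos.2), mul_comm]
      -- By homogeneity, `c * min (f x / A) (g y / B)` is at most the power sum of `f x` and `g y`.
      refine (negPowerSum_mul_min_le k.succ_ne_zero A B ?_).trans ?_
      · exact ENNReal.div_le_of_le_mul (by rw [one_mul]; exact le_iSup f x)
      · rw [ENNReal.mul_div_cancel hA0 hA, ENNReal.mul_div_cancel hB0 hB]
        exact hfgh x y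
  simp_rw [div_eq_mul_inv] at hone
  rw [lintegral_mul_const _ hf, lintegral_mul_const _ hg, lintegral_mul_const _ hh] at hone
  calc negPowerSum k (∫⁻ x, f x) (∫⁻ x, g x)
      ≤ c * ((∫⁻ x, f x) / A + (∫⁻ x, g x) / B) :=
        negPowerSum_le_negPowerSum_succ_mul k hA0 hA hB0 hB _ _
    _ ≤ c * ((∫⁻ x, h x) / c) := by gcongr; exact hone
    _ = ∫⁻ x, h x := ENNReal.mul_div_cancel hcpos.1 hcpos.2

/-- The Borell–Brascamp–Lieb inequality for measurable functions, exponent `-1/(n+k)`. -/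
theorem negPowerSum_lintegral_le_pi (n k : ℕ) {f g h : (Fin n → ℝ) → ℝ≥0∞} (hf : Measurable f)
    (hg : Measurable g) (hh : Measurable h)
    (hfgh : ∀ x y, negPowerSum (n + k) (f x) (g y) ≤ h (x + y)) :
    negPowerSum k (∫⁻ x, f x) (∫⁻ x, g x) ≤ ∫⁻ x, h x := by
  induction n generalizing k with
  | zero =>
    have e : ∀ u : (Fin 0 → ℝ) → ℝ≥0∞, ∫⁻ x, u x = u 0 := by
      intro u
      rw [volume_pi, Measure.pi_of_empty _ 0]
      simp
    rw [e, e, e]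
    simpa using hfgh 0 0
  | succ n ih =>
    let E := (MeasurableEquiv.piFinSuccAbove (fun _ : Fin (n + 1) => ℝ) 0).symm
    have hE : MeasurePreserving E volume volume :=
      (volume_preserving_piFinSuccAbove (fun _ : Fin (n + 1) => ℝ) 0).symm _
    have hadd : ∀ a b : ℝ × (Fin n → ℝ), E (a + b) = E a + E b := by
      intro a b
      ext i
      refine Fin.cases ?_ (fun j => ?_) i <;> simp [E, MeasurableEquiv.piFinSuccAbove]
    have key : ∀ u : (Fin (n + 1) → ℝ) → ℝ≥0∞, Measurable u →
        ∫⁻ x, u x = ∫⁻ a, ∫⁻ b, u (E (a, b)) := by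
      intro u hu
      rw [← hE.lintegral_comp hu, Measure.volume_eq_prod]
      exact lintegral_prod (fun z => u (E z)) (hu.comp E.measurable).aemeasurable
    have hm : ∀ u : (Fin (n + 1) → ℝ) → ℝ≥0∞, Measurable u →
        Measurable fun a => ∫⁻ b, u (E (a, b)) := fun u hu =>
      (hu.comp E.measurable).lintegral_prod_right'
    rw [key f hf, key g hg, key h hh]
    refine negPowerSum_lintegral_le_real k (hm f hf) (hm g hg) (hm h hh) fun a a' => ?_
    -- The slices at first coordinates `a`, `a'` satisfy the `n`-dimensional hypothesis with `k +
    -- 1`; its conclusion is the pointwise hypothesis on the line.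
    refine ih (k + 1) (hf.comp (E.measurable.comp measurable_prodMk_left))
      (hg.comp (E.measurable.comp measurable_prodMk_left))
      (hh.comp (E.measurable.comp measurable_prodMk_left)) fun b b' => ?_
    have := hfgh (E (a, b)) (E (a', b'))
    rw [← hadd] at this
    rwa [show n + (k + 1) = n + 1 + k by ring]

/-! ### Passage to real integrable functions; dilations -/

/-- The pointwise hypothesis holds everywhere, not almost everywhere, so `h` needs a true majorant:
a measurable representative made infinite on a null set. -/
theorem exists_measurable_ge_lintegral_eq_of_aemeasurable {α : Type*} [MeasurableSpace α]
    {μ : Measure α} {u : α → ℝ≥0∞} (hu : AEMeasurable u μ) :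
    ∃ v, Measurable v ∧ u ≤ v ∧ ∫⁻ x, v x ∂μ = ∫⁻ x, u x ∂μ := by
  set N := toMeasurable μ {x | u x ≠ hu.mk u x}
  have hN : μ N = 0 := by rw [measure_toMeasurable]; exact hu.ae_eq_mk
  have hNm : MeasurableSet N := measurableSet_toMeasurable _ _
  have hm : Measurable (N.indicator fun _ => (∞ : ℝ≥0∞)) := measurable_const.indicator hNm
  refine ⟨fun x => hu.mk u x + N.indicator (fun _ => ∞) x, hu.measurable_mk.add hm,
    fun x => ?_, ?_⟩
  · by_cases hx : x ∈ N
    · simp [hx]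
    · have : u x = hu.mk u x := by
        by_contra h
        exact hx (subset_toMeasurable _ _ h)
      simp [hx, this]
  · rw [lintegral_add_left hu.measurable_mk, lintegral_indicator hNm, setLIntegral_measure_zero _ _ hN,
      add_zero]
    exact lintegral_congr_ae hu.ae_eq_mk.symm

theorem negPowerSum_ofReal {n : ℕ} (hn : n ≠ 0) {a b : ℝ} (ha : 0 < a) (hb : 0 < b) :
    negPowerSum n (ENNReal.ofReal a) (ENNReal.ofReal b) =
      ENNReal.ofReal ((a ^ (-(1 / (n : ℝ))) + b ^ (-(1 / (n : ℝ)))) ^ (-(n : ℝ))) := by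
  have ha' : 0 < a ^ (1 / (n : ℝ)) := by positivity
  have hb' : 0 < b ^ (1 / (n : ℝ)) := by positivity
  rw [negPowerSum_of_ne_zero hn, ENNReal.ofReal_rpow_of_pos ha, ENNReal.ofReal_rpow_of_pos hb,
    ← ENNReal.ofReal_inv_of_pos ha', ← ENNReal.ofReal_inv_of_pos hb',
    ← ENNReal.ofReal_add (by positivity) (by positivity), ← ENNReal.ofReal_inv_of_pos (by positivity),
    ← ENNReal.ofReal_pow (by positivity), Real.rpow_neg ha.le, Real.rpow_neg hb.le,
    Real.rpow_neg (by positivity), Real.rpow_natCast, inv_pow]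

theorem min_integral_le_of_negPowerSum_le {n : ℕ} (hn : n ≠ 0)
    {f g h : EuclideanSpace ℝ (Fin n) → ℝ} (hf0 : ∀ x, 0 ≤ f x) (hg0 : ∀ x, 0 ≤ g x)
    (hh0 : ∀ x, 0 ≤ h x) (hf : Integrable f) (hg : Integrable g) (hh : Integrable h)
    (hfgh : ∀ x y, 0 < f x → 0 < g y →
      (f x ^ (-(1 / (n : ℝ))) + g y ^ (-(1 / (n : ℝ)))) ^ (-(n : ℝ)) ≤ h (x + y)) :
    min (∫ x, f x) (∫ x, g x) ≤ ∫ x, h x := by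
  obtain ⟨f', hf'm, hf'le, hf'⟩ := exists_measurable_le_lintegral_eq volume fun x => ENNReal.ofReal (f x)
  obtain ⟨g', hg'm, hg'le, hg'⟩ := exists_measurable_le_lintegral_eq volume fun x => ENNReal.ofReal (g x)
  obtain ⟨h', hh'm, hh'le, hh'⟩ :=
    exists_measurable_ge_lintegral_eq_of_aemeasurable hh.aemeasurable.ennreal_ofReal
  have hpt : ∀ x y, negPowerSum n (f' x) (g' y) ≤ h' (x + y) := by
    intro x y
    refine (negPowerSum_mono n (hf'le x) (hg'le y)).trans (le_trans ?_ (hh'le (x + y)))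
    rcases (hf0 x).eq_or_lt with hx | hx
    · simp [← hx, negPowerSum_zero_left]
    rcases (hg0 y).eq_or_lt with hy | hy
    · simp [← hy, negPowerSum_zero_right]
    rw [negPowerSum_ofReal hn hx hy]
    exact ENNReal.ofReal_le_ofReal (hfgh x y hx hy)
  have hE := PiLp.volume_preserving_toLp (Fin n)
  have hEm := hE.measurable
  have key := negPowerSum_lintegral_le_pi n 0 (hf'm.comp hEm) (hg'm.comp hEm) (hh'm.comp hEm)
    fun x y => hpt (WithLp.toLp 2 x) (WithLp.toLp 2 y)
  simp only [Function.comp_apply] at key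
  rw [negPowerSum_zero, hE.lintegral_comp hf'm, hE.lintegral_comp hg'm, hE.lintegral_comp hh'm,
    ← hf', ← hg', hh', ← ofReal_integral_eq_lintegral_ofReal hf (.of_forall hf0),
    ← ofReal_integral_eq_lintegral_ofReal hg (.of_forall hg0),
    ← ofReal_integral_eq_lintegral_ofReal hh (.of_forall hh0), ← ENNReal.ofReal_min,
    ENNReal.ofReal_le_ofReal_iff (integral_nonneg hh0)] at key
  exact key

theorem min_mul_integral_le {n : ℕ} (hn : n ≠ 0)
    {f g h : EuclideanSpace ℝ (Fin n) → ℝ} (hf0 : ∀ x, 0 ≤ f x) (hg0 : ∀ x, 0 ≤ g x)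
    (hh0 : ∀ x, 0 ≤ h x) (hf : Integrable f) (hg : Integrable g) (hh : Integrable h)
    {α β u v : ℝ} (hα : 0 < α) (hβ : 0 < β) (hu : 0 < u) (hv : 0 < v)
    (hfgh : ∀ x y, 0 < f x → 0 < g y →
      ((u * f x) ^ (-(1 / (n : ℝ))) + (v * g y) ^ (-(1 / (n : ℝ)))) ^ (-(n : ℝ)) ≤
        h (α • x + β • y)) :
    min (u * α ^ n * ∫ x, f x) (v * β ^ n * ∫ x, g x) ≤ ∫ x, h x := by
  have e : ∀ (w : EuclideanSpace ℝ (Fin n) → ℝ) {c r : ℝ}, 0 < r →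
      ∫ x, c * w (r⁻¹ • x) = c * r ^ n * ∫ x, w x := by
    intro w c r hr
    rw [integral_const_mul, Measure.integral_comp_inv_smul_of_nonneg _ _ hr.le,
      finrank_euclideanSpace_fin, smul_eq_mul, mul_assoc]
  rw [← e f hα, ← e g hβ]
  refine min_integral_le_of_negPowerSum_le hn (fun x => mul_nonneg hu.le (hf0 _))
    (fun x => mul_nonneg hv.le (hg0 _)) hh0 ((hf.comp_smul (inv_ne_zero hα.ne')).const_mul u)
    ((hg.comp_smul (inv_ne_zero hβ.ne')).const_mul v) hh fun x y hx hy => ?_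
  have := hfgh (α⁻¹ • x) (β⁻¹ • y) (pos_of_mul_pos_right hx hu.le) (pos_of_mul_pos_right hy hv.le)
  rwa [smul_inv_smul₀ hα.ne', smul_inv_smul₀ hβ.ne'] at this

/-! ### Monotonicity of power means -/

theorem weighted_power_mean_le_geom {w₁ w₂ a b r : ℝ} (hw₁ : 0 < w₁) (hw₂ : 0 < w₂)
    (hw : w₁ + w₂ = 1) (ha : 0 < a) (hb : 0 < b) (hr : r < 0) :
    (w₁ * a ^ r + w₂ * b ^ r) ^ (1 / r) ≤ a ^ w₁ * b ^ w₂ := by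
  have h := Real.geom_mean_le_arith_mean2_weighted hw₁.le hw₂.le
    (Real.rpow_nonneg ha.le r) (Real.rpow_nonneg hb.le r) hw
  have e : a ^ w₁ * b ^ w₂ = ((a ^ r) ^ w₁ * (b ^ r) ^ w₂) ^ (1 / r) := by
    rw [Real.mul_rpow (by positivity) (by positivity), ← Real.rpow_mul ha.le, ← Real.rpow_mul ha.le,
      ← Real.rpow_mul hb.le, ← Real.rpow_mul hb.le]
    have := hr.ne
    congr 2 <;> field_simp
  rw [e]
  exact Real.rpow_le_rpow_of_nonpos (by positivity) h (one_div_neg.2 hr).le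

theorem geom_le_weighted_power_mean {w₁ w₂ a b r : ℝ} (hw₁ : 0 < w₁) (hw₂ : 0 < w₂)
    (hw : w₁ + w₂ = 1) (ha : 0 < a) (hb : 0 < b) (hr : 0 < r) :
    a ^ w₁ * b ^ w₂ ≤ (w₁ * a ^ r + w₂ * b ^ r) ^ (1 / r) := by
  have h := Real.geom_mean_le_arith_mean2_weighted hw₁.le hw₂.le
    (Real.rpow_nonneg ha.le r) (Real.rpow_nonneg hb.le r) hw
  have e : a ^ w₁ * b ^ w₂ = ((a ^ r) ^ w₁ * (b ^ r) ^ w₂) ^ (1 / r) := by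
    rw [Real.mul_rpow (by positivity) (by positivity), ← Real.rpow_mul ha.le, ← Real.rpow_mul ha.le,
      ← Real.rpow_mul hb.le, ← Real.rpow_mul hb.le]
    congr 2 <;> field_simp
  rw [e]
  exact Real.rpow_le_rpow (by positivity) h (one_div_pos.2 hr).le

/-- Monotonicity of weighted power means, from a negative exponent to a nonzero one. -/
theorem weighted_power_mean_le_of_neg {w₁ w₂ a b r s : ℝ} (hw₁ : 0 < w₁) (hw₂ : 0 < w₂)
    (hw : w₁ + w₂ = 1) (ha : 0 < a) (hb : 0 < b) (hr : r < 0) (hrs : r ≤ s) (hs : s ≠ 0) :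
    (w₁ * a ^ r + w₂ * b ^ r) ^ (1 / r) ≤ (w₁ * a ^ s + w₂ * b ^ s) ^ (1 / s) := by
  rcases hs.lt_or_gt with hs' | hs'
  · have hq : 1 ≤ r / s := by rwa [one_le_div_of_neg hs']
    have h := (convexOn_rpow hq).2 (show a ^ s ∈ Ici (0 : ℝ) from (Real.rpow_nonneg ha.le s))
      (show b ^ s ∈ Ici (0 : ℝ) from (Real.rpow_nonneg hb.le s)) hw₁.le hw₂.le hw
    simp only [smul_eq_mul, ← Real.rpow_mul ha.le, ← Real.rpow_mul hb.le,
      mul_div_cancel₀ r hs] at h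
    have e : (w₁ * a ^ s + w₂ * b ^ s) ^ (1 / s) =
        ((w₁ * a ^ s + w₂ * b ^ s) ^ (r / s)) ^ (1 / r) := by
      have := hr.ne
      rw [← Real.rpow_mul (by positivity)]
      congr 1
      field_simp
    rw [e]
    exact Real.rpow_le_rpow_of_nonpos (by positivity) h (one_div_neg.2 hr).le
  · exact (weighted_power_mean_le_geom hw₁ hw₂ hw ha hb hr).trans
      (geom_le_weighted_power_mean hw₁ hw₂ hw ha hb hs')

/-- With weight `C F^γ / N` and rescaled value `a N^(1/s) F^(-γ/s)`, the power mean of exponent `s`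
is built from the terms of the hypothesis on `h`. The next lemma shows that exponent `-1/m` gives
the terms required by `min_mul_integral_le`. -/
theorem weight_mul_rpow_eq {C F N a s γ : ℝ} (hC : 0 < C) (hF : 0 < F) (hN : 0 < N) (ha : 0 < a)
    (hs : s ≠ 0) : C * F ^ γ / N * (a * N ^ (1 / s) * F ^ (-γ / s)) ^ s = C * a ^ s := by
  rw [← Real.exp_log hC, ← Real.exp_log hF, ← Real.exp_log hN, ← Real.exp_log ha]
  simp only [← Real.exp_mul, ← Real.exp_add, ← Real.exp_sub]
  congr 1
  field_simp
  ring

theorem weight_mul_rpow_neg_eq {C F N a s m γ : ℝ} (hC : 0 < C) (hF : 0 < F) (hN : 0 < N)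
    (ha : 0 < a) (hs : s ≠ 0) (hm : m ≠ 0) (hms : 1 + m * s ≠ 0) (hγ : γ = s / (1 + m * s)) :
    C * F ^ γ / N * (a * N ^ (1 / s) * F ^ (-γ / s)) ^ (-(1 / m)) =
      (C ^ (-m) * N ^ (1 / γ) / F * a) ^ (-(1 / m)) := by
  have e : 1 / γ = m + 1 / s := by rw [hγ, one_div_div]; field_simp; ring
  have e' : γ / s = 1 - m * γ := by
    rw [hγ, eq_sub_iff_add_eq, div_right_comm, div_self hs, mul_div_assoc', ← add_div, div_self hms]
  rw [e, neg_div, e', ← Real.exp_log hC, ← Real.exp_log hF, ← Real.exp_log hN, ← Real.exp_log ha]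
  simp only [← Real.exp_mul, ← Real.exp_add, ← Real.exp_sub]
  congr 1
  field_simp
  ring

/-! ### Integral inequalities with fixed coefficients -/

section Integral

variable {n : ℕ} {f g h : EuclideanSpace ℝ (Fin n) → ℝ}

/-- The Borell–Brascamp–Lieb inequality with arbitrary positive coefficients, `s > -1/n`. -/
theorem rpow_sum_integral_le (hn : n ≠ 0) (hf0 : ∀ x, 0 ≤ f x) (hg0 : ∀ x, 0 ≤ g x)
    (hh0 : ∀ x, 0 ≤ h x) (hf : Integrable f) (hg : Integrable g) (hh : Integrable h)
    {C D s : ℝ} (hC : 0 < C) (hD : 0 < D) (hs0 : s ≠ 0) (hs : 0 < 1 + n * s)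
    (hfgh : ∀ x y, 0 < f x → 0 < g y →
      (C * f x ^ s + D * g y ^ s) ^ (1 / s) ≤ h (C • x + D • y))
    (hF : 0 < ∫ x, f x) (hG : 0 < ∫ x, g x) :
    (C * (∫ x, f x) ^ (s / (1 + n * s)) + D * (∫ x, g x) ^ (s / (1 + n * s))) ^
      (1 / (s / (1 + n * s))) ≤ ∫ x, h x := by
  set F := ∫ x, f x
  set G := ∫ x, g x
  set γ := s / (1 + n * s) with hγ
  set N := C * F ^ γ + D * G ^ γ with hN
  have hN0 : 0 < N := by positivity
  have hn' : (n : ℝ) ≠ 0 := by exact_mod_cast hn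
  have hnpos : 0 < (n : ℝ) := by positivity
  -- `u` and `v` solve `u C^n F = v D^n G = N^(1/γ)`, so both entries of the minimum are the target.
  have key := min_mul_integral_le hn hf0 hg0 hh0 hf hg hh hC hD
    (u := C ^ (-(n : ℝ)) * N ^ (1 / γ) / F) (v := D ^ (-(n : ℝ)) * N ^ (1 / γ) / G)
    (by positivity) (by positivity) fun x y hx hy => ?_
  · have e : ∀ {c A : ℝ}, 0 < c → 0 < A →
        c ^ (-(n : ℝ)) * N ^ (1 / γ) / A * c ^ n * A = N ^ (1 / γ) := by
      intro c A hc hA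
      rw [Real.rpow_neg hc.le, Real.rpow_natCast]
      field_simp
    rwa [e hC hF, e hD hG, min_self] at key
  · refine le_trans ?_ (hfgh x y hx hy)
    rw [← weight_mul_rpow_neg_eq hC hF hN0 hx hs0 hn' hs.ne' hγ,
      ← weight_mul_rpow_neg_eq hD hG hN0 hy hs0 hn' hs.ne' hγ,
      ← weight_mul_rpow_eq (γ := γ) hC hF hN0 hx hs0, ← weight_mul_rpow_eq (γ := γ) hD hG hN0 hy hs0]
    have hle : -(1 / (n : ℝ)) ≤ s := by
      rw [neg_le, le_div_iff₀ hnpos]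
      linarith
    have := weighted_power_mean_le_of_neg (w₁ := C * F ^ γ / N) (w₂ := D * G ^ γ / N)
      (a := f x * N ^ (1 / s) * F ^ (-γ / s)) (b := g y * N ^ (1 / s) * G ^ (-γ / s))
      (by positivity) (by positivity) (by rw [← add_div, ← hN, div_self hN0.ne'])
      (by positivity) (by positivity) (neg_lt_zero.2 (one_div_pos.2 hnpos)) hle hs0
    rwa [show 1 / -(1 / (n : ℝ)) = -(n : ℝ) by field_simp] at this

/-- The Prékopa–Leindler inequality. -/
theorem rpow_mul_rpow_integral_le (hn : n ≠ 0) (hf0 : ∀ x, 0 ≤ f x) (hg0 : ∀ x, 0 ≤ g x)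
    (hh0 : ∀ x, 0 ≤ h x) (hf : Integrable f) (hg : Integrable g) (hh : Integrable h)
    {C D : ℝ} (hC : 0 < C) (hD : 0 < D) (hCD : C + D = 1)
    (hfgh : ∀ x y, 0 < f x → 0 < g y → f x ^ C * g y ^ D ≤ h (C • x + D • y))
    (hF : 0 < ∫ x, f x) (hG : 0 < ∫ x, g x) :
    (∫ x, f x) ^ C * (∫ x, g x) ^ D ≤ ∫ x, h x := by
  set F := ∫ x, f x
  set G := ∫ x, g x
  set K := F ^ C * G ^ D with hK
  have hK0 : 0 < K := by positivity
  have hnpos : 0 < (n : ℝ) := by positivity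
  have key := min_mul_integral_le hn hf0 hg0 hh0 hf hg hh hC hD
    (u := C ^ (-(n : ℝ)) * K / F) (v := D ^ (-(n : ℝ)) * K / G)
    (by positivity) (by positivity) fun x y hx hy => ?_
  · have e : ∀ {c A : ℝ}, 0 < c → 0 < A → c ^ (-(n : ℝ)) * K / A * c ^ n * A = K := by
      intro c A hc hA
      rw [Real.rpow_neg hc.le, Real.rpow_natCast]
      field_simp
    rwa [e hC hF, e hD hG, min_self] at key
  · refine le_trans ?_ (hfgh x y hx hy)
    have e : ∀ {c A a : ℝ}, 0 < c → 0 < A → 0 < a →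
        (c ^ (-(n : ℝ)) * K / A * a) ^ (-(1 / (n : ℝ))) = c * (K / A * a) ^ (-(1 / (n : ℝ))) := by
      intro c A a hc hA ha
      rw [mul_div_assoc, mul_assoc, Real.mul_rpow (by positivity) (by positivity),
        ← Real.rpow_mul hc.le, neg_mul_neg, mul_one_div_cancel hnpos.ne', Real.rpow_one]
    rw [e hC hF hx, e hD hG hy]
    have := weighted_power_mean_le_geom (a := K / F * f x) (b := K / G * g y) hC hD hCD
      (by positivity) (by positivity) (neg_lt_zero.2 (one_div_pos.2 hnpos))
    rw [show 1 / -(1 / (n : ℝ)) = -(n : ℝ) by field_simp] at this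
    refine this.trans_eq ?_
    have hKK : (K / F) ^ C * (K / G) ^ D = 1 := by
      rw [Real.div_rpow hK0.le hF.le, Real.div_rpow hK0.le hG.le, div_mul_div_comm,
        ← Real.rpow_add hK0, hCD, Real.rpow_one, ← hK, div_self hK0.ne']
    rw [Real.mul_rpow (by positivity) hx.le, Real.mul_rpow (by positivity) hy.le, mul_mul_mul_comm,
      hKK, one_mul]

/-- The Borell–Brascamp–Lieb inequality of Dancs–Uhrin type, `s ≤ -1/n`. -/
theorem min_rpow_mul_integral_le (hn : n ≠ 0) (hf0 : ∀ x, 0 ≤ f x) (hg0 : ∀ x, 0 ≤ g x)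
    (hh0 : ∀ x, 0 ≤ h x) (hf : Integrable f) (hg : Integrable g) (hh : Integrable h)
    {C D s : ℝ} (hC : 0 < C) (hD : 0 < D) (hs : s ≤ -(1 / (n : ℝ)))
    (hfgh : ∀ x y, 0 < f x → 0 < g y →
      (C * f x ^ s + D * g y ^ s) ^ (1 / s) ≤ h (C • x + D • y)) :
    min (C ^ (n + 1 / s) * ∫ x, f x) (D ^ (n + 1 / s) * ∫ x, g x) ≤ ∫ x, h x := by
  have hnpos : 0 < (n : ℝ) := by positivity
  have hs0 : s < 0 := hs.trans_lt (neg_lt_zero.2 (one_div_pos.2 hnpos))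
  have key := min_mul_integral_le hn hf0 hg0 hh0 hf hg hh hC hD
    (u := C ^ (1 / s)) (v := D ^ (1 / s)) (by positivity) (by positivity) fun x y hx hy => ?_
  · have e : ∀ {c : ℝ}, 0 < c → c ^ (1 / s) * c ^ n = c ^ (n + 1 / s) := fun hc => by
      rw [add_comm, Real.rpow_add hc, Real.rpow_natCast]
    rwa [e hC, e hD] at key
  · refine le_trans ?_ (hfgh x y hx hy)
    -- The ratio of the exponents `-1/n` and `s`; it is at most 1 because `s ≤ -1/n`, so `x ↦ x^θ`
    -- is subadditive.
    set θ := -(1 / (n * s)) with hθ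
    have hns : n * s ≤ -1 := by
      have := mul_le_mul_of_nonneg_left hs hnpos.le
      rwa [mul_neg, mul_one_div_cancel hnpos.ne'] at this
    have hθ0 : 0 ≤ θ := by
      rw [hθ, ← one_div_neg_eq_neg_one_div]
      exact one_div_nonneg.2 (by linarith)
    have hθ1 : θ ≤ 1 := by
      rw [hθ, ← one_div_neg_eq_neg_one_div, div_le_one (by linarith)]
      linarith
    have e : ∀ {c a : ℝ}, 0 < c → 0 < a →
        (c ^ (1 / s) * a) ^ (-(1 / (n : ℝ))) = (c * a ^ s) ^ θ := by
      intro c a hc ha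
      have : c ^ (1 / s) * a = (c * a ^ s) ^ (1 / s) := by
        rw [Real.mul_rpow hc.le (by positivity), ← Real.rpow_mul ha.le, mul_one_div_cancel hs0.ne,
          Real.rpow_one]
      rw [this, ← Real.rpow_mul (by positivity)]
      congr 1
      rw [hθ]
      field_simp
    have e2 : (C * f x ^ s + D * g y ^ s) ^ (1 / s) =
        ((C * f x ^ s + D * g y ^ s) ^ θ) ^ (-(n : ℝ)) := by
      rw [← Real.rpow_mul (by positivity)]
      congr 1
      rw [hθ]
      field_simp
    rw [e hC hx, e hD hy, e2]
    exact Real.rpow_le_rpow_of_nonpos (by positivity)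
      (Real.rpow_add_le_add_rpow (by positivity) (by positivity) hθ0 hθ1) (by linarith)

end Integral

/-! ### The coefficients and the choice of `λ` -/

theorem lpCoeffC_self {p t : ℝ} (ht : t < 1) : lpCoeffC p t t = 1 - t := by
  rw [lpCoeffC, ← Real.rpow_add (sub_pos.2 ht), add_sub_cancel, Real.rpow_one]

theorem lpCoeffD_self {p t : ℝ} (ht : 0 < t) : lpCoeffD p t t = t := by
  rw [lpCoeffD, ← Real.rpow_add ht, add_sub_cancel, Real.rpow_one]

theorem lpCoeffC_pos {p lam t : ℝ} (ht : t < 1) (hl : lam < 1) : 0 < lpCoeffC p lam t :=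
  mul_pos (Real.rpow_pos_of_pos (sub_pos.2 ht) _) (Real.rpow_pos_of_pos (sub_pos.2 hl) _)

theorem lpCoeffD_pos {p lam t : ℝ} (ht : 0 < t) (hl : 0 < lam) : 0 < lpCoeffD p lam t :=
  mul_pos (Real.rpow_pos_of_pos ht _) (Real.rpow_pos_of_pos hl _)

/-- Equality case of Hölder's inequality for the `L_p` coefficients. -/
theorem exists_lpCoeff_rpow_sum_eq {p t γ F G : ℝ} (hp : 1 ≤ p) (ht0 : 0 < t) (ht1 : t < 1)
    (hF : 0 < F) (hG : 0 < G) :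
    ∃ lam, 0 < lam ∧ lam < 1 ∧ lpCoeffC p lam t * F ^ γ + lpCoeffD p lam t * G ^ γ =
      ((1 - t) * F ^ (p * γ) + t * G ^ (p * γ)) ^ (1 / p) := by
  have ht1' : 0 < 1 - t := sub_pos.2 ht1
  set X := (1 - t) * F ^ (p * γ) with hX
  set Y := t * G ^ (p * γ) with hY
  have hX0 : 0 < X := by positivity
  have hY0 : 0 < Y := by positivity
  have hS : 0 < X + Y := by positivity
  have e : ∀ {τ A S : ℝ}, 0 < τ → 0 < A → 0 < S →
      τ ^ (1 / p) * (τ * A ^ (p * γ) / S) ^ (1 - 1 / p) * A ^ γ =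
        τ * A ^ (p * γ) * S ^ (1 / p - 1) := by
    intro τ A S hτ hA hS
    rw [← Real.exp_log hτ, ← Real.exp_log hA, ← Real.exp_log hS]
    simp only [← Real.exp_mul, ← Real.exp_add, ← Real.exp_sub]
    congr 1
    field_simp
    ring
  -- Hölder equality forces `1 - λ` and `λ` to be proportional to `X` and `Y`.
  refine ⟨Y / (X + Y), by positivity, (div_lt_one hS).2 (by linarith), ?_⟩
  have e1 : 1 - Y / (X + Y) = X / (X + Y) := by field_simp; ring
  rw [lpCoeffC, lpCoeffD, e1, hX, hY, e ht1' hF (by positivity), e ht0 hG (by positivity), ← hX,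
    ← hY, ← add_mul, Real.rpow_sub_one hS.ne', mul_div_cancel₀ _ hS.ne']

/-! ### Values of the mean and the main theorem -/

theorem sMean_coe {r α β a b : ℝ} (hr : r ≠ 0) (ha : 0 < a) (hb : 0 < b) :
    sMean (r : EReal) α β a b = (α * a ^ r + β * b ^ r) ^ (1 / r) := by
  simp [sMean, mul_pos ha hb, hr]

theorem sMean_zero {α β a b : ℝ} (ha : 0 < a) (hb : 0 < b) :
    sMean 0 α β a b = a ^ α * b ^ β := by
  simp [sMean, mul_pos ha hb]

theorem sMean_bot {α β a b : ℝ} (ha : 0 < a) (hb : 0 < b) :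
    sMean ⊥ α β a b = min a b := by
  simp [sMean, mul_pos ha hb]

theorem theoremt (n : ℕ) (hn : 0 < n) (p s t : ℝ) (hp : 1 ≤ p) (ht0 : 0 < t) (ht1 : t < 1)
    (f g h : EuclideanSpace ℝ (Fin n) → ℝ)
    (hf0 : ∀ x, 0 ≤ f x) (hg0 : ∀ x, 0 ≤ g x) (hh0 : ∀ x, 0 ≤ h x)
    (hfb : BddAbove (Set.range f)) (hgb : BddAbove (Set.range g)) (hhb : BddAbove (Set.range h))
    (hfi : Integrable f volume) (hgi : Integrable g volume) (hhi : Integrable h volume)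
    (hfgh : ∀ x ∈ Function.support f, ∀ y ∈ Function.support g, ∀ lam ∈ Set.Icc (0 : ℝ) 1,
      sMean (s : EReal) (lpCoeffC p lam t) (lpCoeffD p lam t) (f x) (g y) ≤
        h (lpCoeffC p lam t • x + lpCoeffD p lam t • y)) :
    (-(1 / (n : ℝ)) ≤ s →
      sMean ((p : EReal) * bblExponent n s) (1 - t) t (∫ x, f x) (∫ x, g x) ≤ ∫ x, h x) ∧
    (s < -(1 / (n : ℝ)) →
      ∀ lam ∈ Set.Icc (0 : ℝ) 1,
        min (lpCoeffC p lam t ^ (1 / (s / (1 + (n : ℝ) * s))) * ∫ x, f x)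
          (lpCoeffD p lam t ^ (1 / (s / (1 + (n : ℝ) * s))) * ∫ x, g x) ≤ ∫ x, h x) := by
  have hn0 : n ≠ 0 := hn.ne'
  have hnpos : 0 < (n : ℝ) := by exact_mod_cast hn
  have hp0 : 0 < p := by linarith
  have hF0 : 0 ≤ ∫ x, f x := integral_nonneg hf0
  have hG0 : 0 ≤ ∫ x, g x := integral_nonneg hg0
  have hH0 : 0 ≤ ∫ x, h x := integral_nonneg hh0
  have hpow : s ≠ 0 → ∀ lam ∈ Icc (0 : ℝ) 1, ∀ x y, 0 < f x → 0 < g y →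
      (lpCoeffC p lam t * f x ^ s + lpCoeffD p lam t * g y ^ s) ^ (1 / s) ≤
        h (lpCoeffC p lam t • x + lpCoeffD p lam t • y) := by
    intro hs lam hlam x y hx hy
    have := hfgh x hx.ne' y hy.ne' lam hlam
    rwa [sMean_coe hs hx hy] at this
  refine ⟨fun hs => ?_, fun hs lam hlam => ?_⟩
  · rcases hF0.eq_or_lt with hF | hF
    · simpa [sMean, ← hF] using hH0
    rcases hG0.eq_or_lt with hG | hG
    · simpa [sMean, ← hG] using hH0
    by_cases hs1 : 1 + (n : ℝ) * s = 0
    · have hs' : s = -(1 / (n : ℝ)) := by field_simp; linarith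
      have hs0 : s ≠ 0 := by rintro rfl; simp at hs1
      have key := hpow hs0 t ⟨ht0.le, ht1.le⟩
      rw [lpCoeffC_self ht1, lpCoeffD_self ht0] at key
      have := min_rpow_mul_integral_le hn0 hf0 hg0 hh0 hfi hgi hhi (sub_pos.2 ht1) ht0 hs'.le key
      -- At `s = -1/n` the coefficient powers disappear, leaving the plain minimum.
      have e : (n : ℝ) + 1 / s = 0 := by rw [hs']; field_simp; ring
      rw [e, Real.rpow_zero, Real.rpow_zero, one_mul, one_mul] at this
      rwa [bblExponent, if_pos hs1, EReal.coe_mul_bot_of_pos hp0, sMean_bot hF hG]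
    have hs2 : 0 < 1 + (n : ℝ) * s := by
      refine lt_of_le_of_ne ?_ (Ne.symm hs1)
      have := mul_le_mul_of_nonneg_left hs hnpos.le
      rw [mul_neg, mul_one_div_cancel hnpos.ne'] at this
      linarith
    rw [bblExponent, if_neg hs1, ← EReal.coe_mul]
    by_cases hs0 : s = 0
    · subst hs0
      have key : ∀ x y, 0 < f x → 0 < g y →
          f x ^ (1 - t) * g y ^ t ≤ h ((1 - t) • x + t • y) := by
        intro x y hx hy
        have := hfgh x hx.ne' y hy.ne' t ⟨ht0.le, ht1.le⟩
        rwa [EReal.coe_zero, sMean_zero hx hy, lpCoeffC_self ht1, lpCoeffD_self ht0] at this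
      rw [zero_div, mul_zero, EReal.coe_zero, sMean_zero hF hG]
      exact rpow_mul_rpow_integral_le hn0 hf0 hg0 hh0 hfi hgi hhi (sub_pos.2 ht1) ht0
        (sub_add_cancel 1 t) key hF hG
    · rw [sMean_coe (mul_ne_zero hp0.ne' (div_ne_zero hs0 hs1)) hF hG]
      obtain ⟨lam, hl0, hl1, hlam⟩ := exists_lpCoeff_rpow_sum_eq
        (γ := s / (1 + (n : ℝ) * s)) hp ht0 ht1 hF hG
      have key := rpow_sum_integral_le hn0 hf0 hg0 hh0 hfi hgi hhi (lpCoeffC_pos ht1 hl1)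
        (lpCoeffD_pos ht0 hl0) hs0 hs2 (hpow hs0 lam ⟨hl0.le, hl1.le⟩) hF hG
      have ht1' : 0 < 1 - t := sub_pos.2 ht1
      rwa [hlam, ← Real.rpow_mul (by positivity), one_div_mul_one_div] at key
  · have hs0 : s < 0 := hs.trans (neg_lt_zero.2 (one_div_pos.2 hnpos))
    have hs1 : 1 + (n : ℝ) * s < 0 := by
      have := mul_lt_mul_of_pos_left hs hnpos
      rw [mul_neg, mul_one_div_cancel hnpos.ne'] at this
      linarith
    have hγ : 0 < 1 / (s / (1 + (n : ℝ) * s)) := one_div_pos.2 (div_pos_of_neg_of_neg hs0 hs1)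
    have e : 1 / (s / (1 + (n : ℝ) * s)) = n + 1 / s := by
      rw [one_div_div, add_div, mul_div_cancel_right₀ _ hs0.ne, add_comm]
    have hC0 : 0 ≤ lpCoeffC p lam t :=
      mul_nonneg (Real.rpow_nonneg (by linarith) _) (Real.rpow_nonneg (by linarith [hlam.2]) _)
    have hD0 : 0 ≤ lpCoeffD p lam t :=
      mul_nonneg (Real.rpow_nonneg ht0.le _) (Real.rpow_nonneg hlam.1 _)
    -- A coefficient can vanish when `λ` is an endpoint and `p > 1`; as `1/γ > 0`, the minimum is
    -- then at most zero.
    rcases hC0.eq_or_lt with hC | hC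
    · rw [← hC, Real.zero_rpow hγ.ne', zero_mul]
      exact (min_le_left _ _).trans hH0
    rcases hD0.eq_or_lt with hD | hD
    · rw [← hD, Real.zero_rpow hγ.ne', zero_mul]
      exact (min_le_right _ _).trans hH0
    rw [e]
    exact min_rpow_mul_integral_le hn0 hf0 hg0 hh0 hfi hgi hhi hC hD hs.le
      (hpow hs0.ne lam hlam)
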